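/- Every planar lattice has breadth at most $2$. Here a lattice $L$ is \emph{planar} if it is finite and has a planar diagram: its elements can be represented by distinct points of the plane such that $a<b$ implies that the point of $a$ lies strictly lower than the point of $b$, and such that, when for each covering pair $a\prec b$ the straight line segment (edge) joining the points of $a$ and $b$ is drawn, no edge contains the point of an element other than its two endpoints, and any two distinct edges intersect only in common endpoints. The \emph{breadth} of a lattice $L$ is the least integer $n\ge 0$ such that any join $\bigvee_{i=1}^m x_i$ with $x_i\in L$ and $m\geq n$ is a join of $n$ of the joinands $x_i$ (where the empty join is the least element, so that only a singleton lattice has breadth $0$); it is $\infty$ if there is no such $n$. -/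

import Mathlib

/-- A planar diagram of an ordered set: each element is drawn as a point of the plane, larger
elements are drawn higher, each covering pair `a ⋖ b` is drawn as the straight line segment from
the point of `a` to the point of `b`, no edge passes through the point of an element other than
its endpoints, and two different edges meet only in common endpoints. The second coordinate is
the height. -/
structure IsPlanarDiagram {P : Type*} [PartialOrder P] (pos : P → ℝ × ℝ) : Prop where
  injective : Function.Injective pos
  upward : ∀ a b : P, a < b → (pos a).2 < (pos b).2
  vertex_not_on_edge : ∀ a b c : P, a ⋖ b → pos c ∈ segment ℝ (pos a) (pos b) → c = a ∨ c = b
  edges_not_crossing : ∀ a b c d : P, a ⋖ b → c ⋖ d → (a, b) ≠ (c, d) →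
    ∀ p : ℝ × ℝ, p ∈ segment ℝ (pos a) (pos b) → p ∈ segment ℝ (pos c) (pos d) →
      ∃ v : P, (v = a ∨ v = b) ∧ (v = c ∨ v = d) ∧ p = pos v

/-- An ordered set is planar if it is finite and has a planar diagram. -/
def IsPlanarOrder (P : Type*) [PartialOrder P] : Prop :=
  Finite P ∧ ∃ pos : P → ℝ × ℝ, IsPlanarDiagram pos

/-- Any join of `m ≥ n` elements is already the join of `n` of the joinands. Joins are taken as
least upper bounds, so that the empty join is the least element. -/
def JoinsReduceTo (L : Type*) [Lattice L] (n : ℕ) : Prop :=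
  ∀ (m : ℕ) (x : Fin m → L), n ≤ m → ∀ y : L, IsLUB (Set.range x) y →
    ∃ s : Finset (Fin m), s.card = n ∧ IsLUB (x '' (s : Set (Fin m))) y

/-- The breadth of a lattice: the least `n` such that any join of at least `n` elements is a join
of `n` of the joinands (`⊤` if there is no such `n`, and `0` for the singleton lattice). -/
noncomputable def latticeBreadth (L : Type*) [Lattice L] : ℕ∞ :=
  sInf {k : ℕ∞ | ∃ n : ℕ, k = (n : ℕ∞) ∧ JoinsReduceTo L n}

/-!
Going down and up from an element `b` along covering pairs traces a curve in the diagram whose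
vertices are all comparable with `b`. In a planar diagram two such curves meet only at vertices or
along common edges. So the curves through two incomparable elements do not cross between the
heights of these elements, which makes it consistent to say that one element is to the left of the
other. Among three pairwise incomparable elements some `b` has one of the others, `a`, on its left
and the other one, `c`, on its right. Wherever `a ⊔ c` lies, a curve going up from `a` or from `c`
to `a ⊔ c` has to cross the curve through `b`, and hence passes through an element comparable with
`b`. That element is not below `b`, so it is above `b`, and `b ≤ a ⊔ c`. Thus any join of more than
two elements has a redundant joinand.
-/

section Strands

open Set Relation

/-- The part of a diagram drawn by the elements of `S`: the points of `S` and the edges with both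
endpoints in `S`. Using `⩿` instead of `⋖` treats a point as a degenerate edge. -/
def drawing {P : Type*} [Preorder P] (pos : P → ℝ × ℝ) (S : Set P) : Set (ℝ × ℝ) :=
  {p | ∃ a ∈ S, ∃ b ∈ S, a ⩿ b ∧ p ∈ segment ℝ (pos a) (pos b)}

/-- A strand from `u` to `v` along `S`: a curve in the drawing of `S` from the point of `u` to the
point of `v`. It is encoded as a continuous function from heights to horizontal coordinates, whose
values outside the heights between `u` and `v` are irrelevant. -/
structure IsStrand {P : Type*} [Preorder P] (pos : P → ℝ × ℝ) (S : Set P) (u v : P)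
    (f : ℝ → ℝ) : Prop where
  continuous : Continuous f
  left : f (pos u).2 = (pos u).1
  right : f (pos v).2 = (pos v).1
  mem_drawing : ∀ y ∈ Icc (pos u).2 (pos v).2, (f y, y) ∈ drawing pos S

/-- A strand from `u` to `v` that passes through the point of `a` and runs along elements
comparable with `a`; it divides the part of the diagram between `u` and `v` into a left and a right
side. -/
structure IsStrandThrough {P : Type*} [Preorder P] (pos : P → ℝ × ℝ) (u v a : P)
    (f : ℝ → ℝ) : Prop extends IsStrand pos (Iic a ∪ Ici a) u v f where
  apply_height : f (pos a).2 = (pos a).1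

/-- The element `a` is to the left of `b`, as seen from the strands `f a` and `f b` chosen through
`a` and `b`: the point of `a` is weakly left of `f b`, and that of `b` weakly right of `f a`. -/
def IsLeftOf {P : Type*} (pos : P → ℝ × ℝ) (f : P → ℝ → ℝ) (a b : P) : Prop :=
  (pos a).1 ≤ f b (pos a).2 ∧ f a (pos b).2 ≤ (pos b).1

section Preorder

variable {P : Type*} [Preorder P] {pos : P → ℝ × ℝ} {S T : Set P} {u v w : P} {f g : ℝ → ℝ}

theorem drawing_mono (h : S ⊆ T) : drawing pos S ⊆ drawing pos T :=
  fun _ ⟨a, ha, b, hb, hab, hp⟩ => ⟨a, h ha, b, h hb, hab, hp⟩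

theorem mem_drawing_of_mem {a : P} (ha : a ∈ S) : pos a ∈ drawing pos S :=
  ⟨a, ha, a, ha, .rfl, left_mem_segment ℝ _ _⟩

theorem nonempty_of_mem_drawing {p : ℝ × ℝ} (hp : p ∈ drawing pos S) : S.Nonempty :=
  let ⟨a, ha, _⟩ := hp
  ⟨a, ha⟩

theorem snd_mem_Icc_of_mem_segment {p q r : ℝ × ℝ} (hpq : p.2 ≤ q.2) (hr : r ∈ segment ℝ p q) :
    r.2 ∈ Icc p.2 q.2 :=
  segment_subset_Icc hpq <|
    image_segment ℝ (LinearMap.snd ℝ ℝ ℝ).toAffineMap p q ▸ mem_image_of_mem Prod.snd hr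

namespace IsStrand

theorem mono (hf : IsStrand pos S u v f) (h : S ⊆ T) : IsStrand pos T u v f :=
  { hf with mem_drawing := fun y hy => drawing_mono h (hf.mem_drawing y hy) }

theorem refl (hu : u ∈ S) : IsStrand pos S u u fun _ => (pos u).1 where
  continuous := continuous_const
  left := rfl
  right := rfl
  mem_drawing y hy := by
    obtain rfl : y = (pos u).2 := le_antisymm hy.2 hy.1
    exact mem_drawing_of_mem hu

theorem of_wcovBy (huv : u ⩿ v) (hu : u ∈ S) (hv : v ∈ S) (hlt : (pos u).2 < (pos v).2) :
    IsStrand pos S u v fun y =>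
      (pos u).1 + (y - (pos u).2) / ((pos v).2 - (pos u).2) * ((pos v).1 - (pos u).1) where
  continuous := by fun_prop
  left := by simp
  right := by simp [(sub_pos.2 hlt).ne']
  mem_drawing y hy := by
    have hpos : 0 < (pos v).2 - (pos u).2 := sub_pos.2 hlt
    refine ⟨u, hu, v, hv, huv, ?_⟩
    rw [segment_eq_image']
    refine ⟨(y - (pos u).2) / ((pos v).2 - (pos u).2),
      ⟨div_nonneg (sub_nonneg.2 hy.1) hpos.le,
        (div_le_one hpos).2 (sub_le_sub_right hy.2 _)⟩, ?_⟩
    ext <;> simp [hpos.ne']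

theorem trans (hf : IsStrand pos S u v f) (hg : IsStrand pos S v w g)
    (huv : (pos u).2 ≤ (pos v).2) (hvw : (pos v).2 ≤ (pos w).2) :
    IsStrand pos S u w fun y => if y ≤ (pos v).2 then f y else g y where
  continuous := hf.continuous.if_le hg.continuous continuous_id continuous_const <| by
    rintro y rfl
    exact hf.right.trans hg.left.symm
  left := by rw [if_pos huv, hf.left]
  right := by
    rcases hvw.eq_or_lt with heq | hlt
    · rw [if_pos heq.ge, ← heq, hf.right, ← hg.left, heq, hg.right]
    · rw [if_neg hlt.not_ge, hg.right]
  mem_drawing y hy := by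
    split_ifs with h
    · exact hf.mem_drawing y ⟨hy.1, h⟩
    · exact hg.mem_drawing y ⟨(not_le.1 h).le, hy.2⟩

end IsStrand

end Preorder

section Upward

variable {P : Type*} [PartialOrder P] {pos : P → ℝ × ℝ} {a b u v : P}

theorem exists_isStrand_Icc (hpos : StrictMono fun x => (pos x).2)
    (hab : ReflTransGen (· ⋖ ·) a b) : ∃ f, IsStrand pos (Icc a b) a b f := by
  induction hab with
  | refl => exact ⟨_, .refl (left_mem_Icc.2 le_rfl)⟩
  | @tail c d hac hcd ih =>
    obtain ⟨f, hf⟩ := ih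
    have hac : a ≤ c := reflTransGen_le_of_le (r := (· ≤ ·)) (fun _ _ => CovBy.le) _ _ hac
    exact ⟨_, (hf.mono (Icc_subset_Icc_right hcd.le)).trans
      (.of_wcovBy hcd.wcovBy ⟨hac, hcd.le⟩ (right_mem_Icc.2 (hac.trans hcd.le)) (hpos hcd.lt))
      (hpos.monotone hac) (hpos hcd.lt).le⟩

theorem exists_isStrandThrough (hpos : StrictMono fun x => (pos x).2)
    (hcov : ∀ x y : P, x ≤ y → ReflTransGen (· ⋖ ·) x y) (ha : a ∈ Icc u v) :
    ∃ f, IsStrandThrough pos u v a f := by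
  obtain ⟨f, hf⟩ := exists_isStrand_Icc hpos (hcov u a ha.1)
  obtain ⟨g, hg⟩ := exists_isStrand_Icc hpos (hcov a v ha.2)
  have hf' := hf.mono (Icc_subset_Iic_self.trans (subset_union_left (t := Ici a)))
  have hg' := hg.mono (Icc_subset_Ici_self.trans (subset_union_right (s := Iic a)))
  exact ⟨_, hf'.trans hg' (hpos.monotone ha.1) (hpos.monotone ha.2), by simp [hf.right]⟩

theorem le_of_snd_le_of_comparable (hpos : StrictMono fun x => (pos x).2)
    (hcomp : a ∈ Iic b ∪ Ici b) (hle : (pos a).2 ≤ (pos b).2) : a ≤ b :=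
  hcomp.elim id fun hba => (eq_of_le_of_not_lt hba fun hlt => (hpos hlt).not_ge hle).ge

/-- The edge through `p` would have `a` between its endpoints, hence as one of them, although both
are comparable with `b`. -/
theorem notMem_drawing_of_incompRel (hpos : StrictMono fun x => (pos x).2)
    (hab : IncompRel (· ≤ ·) a b) {p : ℝ × ℝ} (hp : p.2 ∈ Icc (pos a).2 (pos b).2) :
    p ∉ drawing pos ((Iic a ∪ Ici a) ∩ (Iic b ∪ Ici b)) := by
  rintro ⟨c, ⟨hca, hcb⟩, d, ⟨hda, hdb⟩, hcd, hpcd⟩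
  obtain ⟨hcp, hpd⟩ := snd_mem_Icc_of_mem_segment (hpos.monotone hcd.le) hpcd
  have hcb : c ≤ b := le_of_snd_le_of_comparable hpos hcb (hcp.trans hp.2)
  have had : a ≤ d := le_of_snd_le_of_comparable hpos hda.symm (hp.1.trans hpd)
  have hca : c ≤ a := hca.resolve_right fun hac => hab.not_le (le_trans hac hcb)
  rcases hcd.eq_or_eq hca had with rfl | rfl
  · exact hab.not_le hcb
  · exact hdb.elim hab.not_le hab.not_ge

end Upward

namespace IsPlanarDiagram

variable {P : Type*} [PartialOrder P] {pos : P → ℝ × ℝ} {a b u v : P} {S T : Set P}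

theorem strictMono_snd (h : IsPlanarDiagram pos) : StrictMono fun x => (pos x).2 :=
  h.upward

theorem drawing_inter (h : IsPlanarDiagram pos) (S T : Set P) :
    drawing pos (S ∩ T) = drawing pos S ∩ drawing pos T := by
  refine Subset.antisymm
    (subset_inter (drawing_mono inter_subset_left) (drawing_mono inter_subset_right)) ?_
  rintro p ⟨⟨a, ha, b, hb, hab, hp⟩, c, hc, d, hd, hcd, hq⟩
  have mem_of_vertex {x : P} (hxS : x = a ∨ x = b) (hxT : x = c ∨ x = d) (hpx : p = pos x) :
      p ∈ drawing pos (S ∩ T) :=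
    hpx ▸ mem_drawing_of_mem
      ⟨by rcases hxS with rfl | rfl <;> assumption, by rcases hxT with rfl | rfl <;> assumption⟩
  rcases wcovBy_iff_covBy_or_eq.1 hab with hab' | rfl
  · rcases wcovBy_iff_covBy_or_eq.1 hcd with hcd' | rfl
    · by_cases heq : (a, b) = (c, d)
      · obtain ⟨rfl, rfl⟩ := Prod.mk.inj heq
        exact ⟨a, ⟨ha, hc⟩, b, ⟨hb, hd⟩, hab, hp⟩
      · obtain ⟨x, hxS, hxT, hpx⟩ := h.edges_not_crossing a b c d hab' hcd' heq p hp hq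
        exact mem_of_vertex hxS hxT hpx
    · obtain rfl : p = pos c := by simpa using hq
      exact mem_of_vertex (h.vertex_not_on_edge a b c hab' hp) (.inl rfl) rfl
  · obtain rfl : p = pos a := by simpa using hp
    rcases wcovBy_iff_covBy_or_eq.1 hcd with hcd' | rfl
    · exact mem_of_vertex (.inl rfl) (h.vertex_not_on_edge c d a hcd' hq) rfl
    · exact mem_of_vertex (.inl rfl) (.inl (h.injective (by simpa using hq))) rfl

theorem exists_mem_drawing_inter (h : IsPlanarDiagram pos) {u' v' : P} {f g : ℝ → ℝ} {s t : ℝ}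
    (hf : IsStrand pos S u v f) (hg : IsStrand pos T u' v' g) (hst : s ≤ t)
    (hfI : Icc s t ⊆ Icc (pos u).2 (pos v).2) (hgI : Icc s t ⊆ Icc (pos u').2 (pos v').2)
    (hs : f s ≤ g s) (ht : g t ≤ f t) :
    ∃ y ∈ Icc s t, (f y, y) ∈ drawing pos (S ∩ T) := by
  obtain ⟨y, hy, hfg⟩ := isPreconnected_Icc.intermediate_value₂ (left_mem_Icc.2 hst)
    (right_mem_Icc.2 hst) hf.continuous.continuousOn hg.continuous.continuousOn hs ht
  rw [h.drawing_inter]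
  exact ⟨y, hy, hf.mem_drawing y (hfI hy), hfg ▸ hg.mem_drawing y (hgI hy)⟩

theorem isLeftOf_or_isLeftOf (h : IsPlanarDiagram pos) {f : P → ℝ → ℝ}
    (ha : a ∈ Icc u v) (hb : b ∈ Icc u v) (hfa : IsStrandThrough pos u v a (f a))
    (hfb : IsStrandThrough pos u v b (f b)) (hab : IncompRel (· ≤ ·) a b) :
    IsLeftOf pos f a b ∨ IsLeftOf pos f b a := by
  wlog hle : (pos a).2 ≤ (pos b).2 generalizing a b
  · exact (this hb ha hfb hfa hab.symm (le_of_not_ge hle)).symm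
  have hI : Icc (pos a).2 (pos b).2 ⊆ Icc (pos u).2 (pos v).2 :=
    Icc_subset_Icc (h.strictMono_snd.monotone ha.1) (h.strictMono_snd.monotone hb.2)
  unfold IsLeftOf
  rw [← hfa.apply_height, ← hfb.apply_height]
  rcases le_total (f a (pos a).2) (f b (pos a).2) with hal | har <;>
    rcases le_total (f a (pos b).2) (f b (pos b).2) with hbr | hbl
  · exact .inl ⟨hal, hbr⟩
  · obtain ⟨y, hy, hmem⟩ :=
      h.exists_mem_drawing_inter hfa.toIsStrand hfb.toIsStrand hle hI hI hal hbl
    exact (notMem_drawing_of_incompRel h.strictMono_snd hab hy hmem).elim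
  · obtain ⟨y, hy, hmem⟩ :=
      h.exists_mem_drawing_inter hfb.toIsStrand hfa.toIsStrand hle hI hI har hbr
    exact (notMem_drawing_of_incompRel h.strictMono_snd hab hy (inter_comm _ _ ▸ hmem)).elim
  · exact .inr ⟨hbl, har⟩

/-- One of the strands from `a` and `c` up to `d` has to cross the strand `g` through `b`. -/
theorem le_of_left_of_right (h : IsPlanarDiagram pos)
    (hcov : ∀ x y : P, x ≤ y → ReflTransGen (· ⋖ ·) x y) {c d : P} {g : ℝ → ℝ}
    (hg : IsStrandThrough pos u v b g) (hua : u ≤ a) (huc : u ≤ c) (had : a ≤ d) (hcd : c ≤ d)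
    (hdv : d ≤ v) (hab : ¬ a ≤ b) (hcb : ¬ c ≤ b) (hleft : (pos a).1 ≤ g (pos a).2)
    (hright : g (pos c).2 ≤ (pos c).1) : b ≤ d := by
  have hmono := h.strictMono_snd.monotone
  have le_of_mem_inter {x w : P} (hxb : ¬ x ≤ b) (hw : w ∈ Icc x d ∩ (Iic b ∪ Ici b)) : b ≤ d :=
    (hw.2.resolve_left fun hwb => hxb (hw.1.1.trans hwb)).trans hw.1.2
  rcases le_total (pos d).1 (g (pos d).2) with hd | hd
  · obtain ⟨f, hf⟩ := exists_isStrand_Icc h.strictMono_snd (hcov c d hcd)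
    obtain ⟨y, -, hmem⟩ := h.exists_mem_drawing_inter hg.toIsStrand hf (hmono hcd)
      (Icc_subset_Icc (hmono huc) (hmono hdv)) Subset.rfl (hright.trans_eq hf.left.symm)
      (hf.right.trans_le hd)
    obtain ⟨w, hw⟩ := nonempty_of_mem_drawing hmem
    exact le_of_mem_inter hcb hw.symm
  · obtain ⟨f, hf⟩ := exists_isStrand_Icc h.strictMono_snd (hcov a d had)
    obtain ⟨y, -, hmem⟩ := h.exists_mem_drawing_inter hf hg.toIsStrand (hmono had)
      Subset.rfl (Icc_subset_Icc (hmono hua) (hmono hdv)) (hf.left.trans_le hleft)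
      (hd.trans_eq hf.right.symm)
    obtain ⟨w, hw⟩ := nonempty_of_mem_drawing hmem
    exact le_of_mem_inter hab hw

theorem le_sup_or_le_sup_or_le_sup {L : Type*} [Lattice L] {pos : L → ℝ × ℝ}
    (h : IsPlanarDiagram pos) (hcov : ∀ x y : L, x ≤ y → ReflTransGen (· ⋖ ·) x y) (a b c : L) :
    a ≤ b ⊔ c ∨ b ≤ a ⊔ c ∨ c ≤ a ⊔ b := by
  by_contra! ⟨hna, hnb, hnc⟩
  have hab : IncompRel (· ≤ ·) a b := ⟨mt le_sup_of_le_left hna, mt le_sup_of_le_left hnb⟩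
  have hac : IncompRel (· ≤ ·) a c := ⟨mt le_sup_of_le_right hna, mt le_sup_of_le_left hnc⟩
  have hbc : IncompRel (· ≤ ·) b c := ⟨mt le_sup_of_le_right hnb, mt le_sup_of_le_right hnc⟩
  let I := Icc (a ⊓ b ⊓ c) (a ⊔ b ⊔ c)
  have ha : a ∈ I := ⟨inf_le_left.trans inf_le_left, le_sup_left.trans le_sup_left⟩
  have hb : b ∈ I := ⟨inf_le_left.trans inf_le_right, le_sup_right.trans le_sup_left⟩
  have hc : c ∈ I := ⟨inf_le_right, le_sup_right⟩
  choose! f hf using fun x (hx : x ∈ I) => exists_isStrandThrough h.strictMono_snd hcov hx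
  have total {x y : L} (hx : x ∈ I) (hy : y ∈ I) (hxy : IncompRel (· ≤ ·) x y) :
      IsLeftOf pos f x y ∨ IsLeftOf pos f y x :=
    h.isLeftOf_or_isLeftOf hx hy (hf x hx) (hf y hy) hxy
  have between {x y z : L} (hx : x ∈ I) (hy : y ∈ I) (hz : z ∈ I)
      (hxy : IncompRel (· ≤ ·) x y) (hyz : IncompRel (· ≤ ·) y z)
      (lxy : IsLeftOf pos f x y) (lyz : IsLeftOf pos f y z) : y ≤ x ⊔ z :=
    h.le_of_left_of_right hcov (hf y hy) hx.1 hz.1 le_sup_left le_sup_right (sup_le hx.2 hz.2)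
      hxy.not_le hyz.not_ge lxy.1 lyz.2
  -- Even if the relation is cyclic, some element has one of the others on either side.
  rcases total ha hb hab with lab | lba <;> rcases total hb hc hbc with lbc | lcb
  · exact hnb (between ha hb hc hab hbc lab lbc)
  · rcases total ha hc hac with lac | lca
    · exact hnc (between ha hc hb hac hbc.symm lac lcb)
    · exact hna (sup_comm b c ▸ between hc ha hb hac.symm hab lca lab)
  · rcases total ha hc hac with lac | lca
    · exact hna (between hb ha hc hab.symm hac lba lac)
    · exact hnc (sup_comm a b ▸ between hb hc ha hbc hac.symm lbc lca)
  · exact hnb (sup_comm a c ▸ between hc hb ha hbc.symm hab.symm lcb lba)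

end IsPlanarDiagram

end Strands

theorem exists_subset_card_eq_isLUB_image {ι α : Type*} [DecidableEq ι] [Preorder α] {x : ι → α}
    {n : ℕ} (h : ∀ t : Finset ι, t.card = n + 1 →
      ∃ i ∈ t, ∀ z ∈ upperBounds (x '' (t.erase i : Set ι)), x i ≤ z)
    {s : Finset ι} (hs : n ≤ s.card) {y : α} (hy : IsLUB (x '' (s : Set ι)) y) :
    ∃ t ⊆ s, t.card = n ∧ IsLUB (x '' (t : Set ι)) y := by
  induction s using Finset.strongInduction with
  | H s ih =>
    rcases hs.eq_or_lt with hcard | hcard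
    · exact ⟨s, subset_rfl, hcard.symm, hy⟩
    obtain ⟨t, hts, ht⟩ := Finset.exists_subset_card_eq (Nat.succ_le_of_lt hcard)
    obtain ⟨i, hit, hi⟩ := h t ht
    have upperBounds_erase : upperBounds (x '' (s : Set ι)) =
        upperBounds (x '' (s.erase i : Set ι)) := by
      rw [← Finset.insert_erase (hts hit), Finset.coe_insert, Set.image_insert_eq,
        upperBounds_insert, Finset.erase_insert (Finset.notMem_erase i s), Set.inter_eq_right]
      exact fun z hz => hi z <|
        upperBounds_mono_set (Set.image_mono (Finset.erase_subset_erase i hts)) hz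
    obtain ⟨r, hr, hrcard, hry⟩ := ih (s.erase i) (Finset.erase_ssubset (hts hit))
      ((Nat.le_sub_one_of_lt hcard).trans_eq (Finset.card_erase_of_mem (hts hit)).symm)
      ((isLUB_congr upperBounds_erase).1 hy)
    exact ⟨r, hr.trans (Finset.erase_subset i s), hrcard, hry⟩

theorem joinsReduceTo_two {L : Type*} [Lattice L]
    (h : ∀ a b c : L, a ≤ b ⊔ c ∨ b ≤ a ⊔ c ∨ c ≤ a ⊔ b) : JoinsReduceTo L 2 := by
  intro m x hm y hy
  have exists_redundant (t : Finset (Fin m)) (ht : t.card = 2 + 1) :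
      ∃ i ∈ t, ∀ z ∈ upperBounds (x '' (t.erase i : Set (Fin m))), x i ≤ z := by
    obtain ⟨i, j, k, hij, hik, hjk, rfl⟩ := Finset.card_eq_three.1 ht
    rcases h (x i) (x j) (x k) with hi | hj | hk
    · exact ⟨i, by simp, fun z hz =>
        hi.trans (sup_le (hz ⟨j, by grind, rfl⟩) (hz ⟨k, by grind, rfl⟩))⟩
    · exact ⟨j, by simp, fun z hz =>
        hj.trans (sup_le (hz ⟨i, by grind, rfl⟩) (hz ⟨k, by grind, rfl⟩))⟩
    · exact ⟨k, by simp, fun z hz =>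
        hk.trans (sup_le (hz ⟨i, by grind, rfl⟩) (hz ⟨j, by grind, rfl⟩))⟩
  obtain ⟨s, -, hs⟩ := exists_subset_card_eq_isLUB_image exists_redundant
    (s := Finset.univ) (by simpa using hm) (by simpa using hy)
  exact ⟨s, hs⟩

theorem mainTheorem6_general {L : Type*} [Lattice L]
    (hcov : ∀ a b : L, a ≤ b → Relation.ReflTransGen (· ⋖ ·) a b)
    {pos : L → ℝ × ℝ} (h : IsPlanarDiagram pos) : latticeBreadth L ≤ 2 :=
  sInf_le ⟨2, rfl, joinsReduceTo_two (h.le_sup_or_le_sup_or_le_sup hcov)⟩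

theorem mainTheorem6 (L : Type*) [Lattice L] (hL : IsPlanarOrder L) :
    latticeBreadth L ≤ 2 := by
  classical
  obtain ⟨_, pos, hpos⟩ := hL
  let _ := Fintype.ofFinite L
  let _ := Fintype.toLocallyFiniteOrder (α := L)
  exact mainTheorem6_general (fun _ _ => le_iff_reflTransGen_covBy.1) hpos
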